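/- Let $n\ge 1$ and let $\Omega\subset\mathbb R^n$ be a bounded open set with $C^1$ boundary, with outward unit normal $\mathbf n$ and surface measure $\sigma$ on $\partial\Omega$. Let $V:=W^3(\mathrm{div};\Omega)=\{\mathbf v\in L^3(\Omega)^n:\ \mathrm{div}\,\mathbf v\in L^3(\Omega)\}$, with the divergence in the weak sense and the norm $\|\mathbf v\|_V=\bigl(\int_\Omega\sum_i|v_i|^3\,dx+\int_\Omega|\mathrm{div}\,\mathbf v|^3\,dx\bigr)^{1/3}$, and let $Q:=L^{3/2}(\Omega)$. Let $\alpha,\beta\in L^\infty(\Omega)$ with $0<\underline\alpha\le\alpha(x)\le\overline\alpha<\infty$ and $0<\underline\beta\le\beta(x)\le\overline\beta<\infty$ for almost every $x\in\Omega$, where $\underline\alpha,\overline\alpha,\underline\beta,\overline\beta$ are constants; let $f\in L^3(\Omega)$ and $S_b\in W^{1/3,3/2}(\partial\Omega)$. Then for every $\varepsilon>0$ there is exactly one pair $(\mathbf m_\varepsilon,S_\varepsilon)\in V\times Q$ such that $$\int_\Omega(\alpha+\beta|\mathbf m_\varepsilon|)\,\mathbf m_\varepsilon\cdot\mathbf v\,dx+\varepsilon\int_\Omega|\mathrm{div}\,\mathbf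 m_\varepsilon|\,\mathrm{div}\,\mathbf m_\varepsilon\,\mathrm{div}\,\mathbf v\,dx-\int_\Omega \mathrm{div}\,\mathbf v\;S_\varepsilon\,dx=-\int_{\partial\Omega}S_b\,(\mathbf v\cdot\mathbf n)\,d\sigma\qquad\text{for all }\mathbf v\in V,$$ $$\varepsilon\int_\Omega\frac{S_\varepsilon}{\sqrt{|S_\varepsilon|}}\,q\,dx+\int_\Omega\mathrm{div}\,\mathbf m_\varepsilon\;q\,dx=\int_\Omega f\,q\,dx\qquad\text{for all }q\in Q,$$ where $S/\sqrt{|S|}:=0$ where $S=0$, and where $\mathbf v\mapsto\int_{\partial\Omega}S_b\,(\mathbf v\cdot\mathbf n)\,d\sigma$ denotes the continuous linear extension to $V$ of this boundary integral from the restrictions to $\Omega$ of fields in $C_c^\infty(\mathbb R^n)^n$ (which are dense in $V$). -/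

import Mathlib

open MeasureTheory Filter Topology
open scoped ENNReal ContDiff RealInnerProductSpace

namespace DarcyForchheimer

/-- The Euclidean space `ℝⁿ`. -/
abbrev E (n : ℕ) : Type := EuclideanSpace ℝ (Fin n)

section Domain

variable {n : ℕ}

/-- `Ω` has a `C¹` boundary: near each boundary point a `C¹` diffeomorphism between open sets of
`ℝⁿ` takes `Ω` to the part of its range where one fixed coordinate is positive. For a bounded `Ω`
the boundary is compact, and this is the uniform `C¹`-regularity property. -/
def HasC1Boundary (Ω : Set (E n)) : Prop :=
  ∀ x ∈ frontier Ω, ∃ (e : OpenPartialHomeomorph (E n) (E n)) (i : Fin n),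
    x ∈ e.source ∧ ContDiffOn ℝ 1 e e.source ∧ ContDiffOn ℝ 1 e.symm e.target ∧
    ∀ y ∈ e.source, y ∈ Ω ↔ 0 < e y i

/-- `ν` is the outward unit normal of `Ω` at `x`: directions that make an obtuse angle with `ν`
lead into `Ω`, those that make an acute angle lead out of the closure of `Ω`. There is at most one
such `ν` (`IsOuterUnitNormal.unique`); on a `C¹` boundary it exists. -/
def IsOuterUnitNormal (Ω : Set (E n)) (x ν : E n) : Prop :=
  ‖ν‖ = 1 ∧
  (∀ w : E n, ⟪w, ν⟫ < 0 → ∀ᶠ t : ℝ in 𝓝[>] 0, x + t • w ∈ Ω) ∧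
  (∀ w : E n, 0 < ⟪w, ν⟫ → ∀ᶠ t : ℝ in 𝓝[>] 0, x + t • w ∉ closure Ω)

theorem IsOuterUnitNormal.unique {Ω : Set (E n)} {x ν ν' : E n}
    (h : IsOuterUnitNormal Ω x ν) (h' : IsOuterUnitNormal Ω x ν') : ν = ν' := by
  by_contra hne
  have h1 : ⟪ν, ν'⟫ < 1 := (inner_lt_one_iff_real_of_norm_eq_one h.1 h'.1).2 hne
  have hν : ⟪ν, ν⟫ = (1 : ℝ) := by rw [real_inner_self_eq_norm_sq, h.1]; norm_num
  have hν' : ⟪ν', ν'⟫ = (1 : ℝ) := by rw [real_inner_self_eq_norm_sq, h'.1]; norm_num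
  have hA := h.2.1 (ν' - ν) (by rw [inner_sub_left, hν, real_inner_comm]; linarith)
  have hB := h'.2.2 (ν' - ν) (by rw [inner_sub_left, hν']; linarith)
  obtain ⟨t, ht, ht'⟩ := (hA.and hB).exists
  exact ht' (subset_closure ht)

open Classical in
/-- The outward unit normal field of `Ω` (`0` at points where there is none). -/
noncomputable def outerNormal (Ω : Set (E n)) (x : E n) : E n :=
  if h : ∃ ν, IsOuterUnitNormal Ω x ν then h.choose else 0

/-- The surface measure on `∂Ω`: the `(n-1)`-dimensional Hausdorff measure, normalized as the
Lebesgue measure, restricted to `∂Ω`. -/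
noncomputable def surfaceMeasure (Ω : Set (E n)) : Measure (E n) :=
  (Measure.euclideanHausdorffMeasure (n - 1)).restrict (frontier Ω)

/-- `u` belongs to the Sobolev-Slobodeckij space `W^{σ,p}(∂Ω)`, `0 < σ < 1`. -/
def MemSlobodeckij (Ω : Set (E n)) (σ p : ℝ) (u : E n → ℝ) : Prop :=
  MemLp u (ENNReal.ofReal p) (surfaceMeasure Ω) ∧
  ∫⁻ x, ∫⁻ y, ‖u x - u y‖ₑ ^ p / edist x y ^ ((n : ℝ) - 1 + σ * p)
    ∂(surfaceMeasure Ω) ∂(surfaceMeasure Ω) < ⊤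

end Domain

section Spaces

variable {n : ℕ}

/-- `L^s(Ω)`. -/
abbrev LpS (Ω : Set (E n)) (s : ℝ≥0∞) : Type := Lp ℝ s (volume.restrict Ω)

/-- `(L^s(Ω))ⁿ`. -/
abbrev LpV (Ω : Set (E n)) (s : ℝ≥0∞) : Type := Lp (E n) s (volume.restrict Ω)

/-- `d` is the weak (distributional) divergence of `v` on `Ω`:
`∫_Ω v · ∇φ = - ∫_Ω d φ` for all test functions `φ`. -/
def HasWeakDiv (Ω : Set (E n)) (v : E n → E n) (d : E n → ℝ) : Prop :=
  ∀ φ : E n → ℝ, ContDiff ℝ ∞ φ → HasCompactSupport φ → tsupport φ ⊆ Ω →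
    ∫ x in Ω, ⟪v x, gradient φ x⟫ = - ∫ x in Ω, d x * φ x

theorem integrable_inner_gradient {Ω : Set (E n)} {s : ℝ≥0∞} (hs : 1 ≤ s) (v : LpV Ω s)
    {φ : E n → ℝ} (h1 : ContDiff ℝ ∞ φ) (h2 : HasCompactSupport φ) :
    Integrable (fun x => ⟪v x, gradient φ x⟫) (volume.restrict Ω) := by
  have hc : Continuous (gradient φ) :=
    (InnerProductSpace.toDual ℝ (E n)).symm.continuous.comp (h1.continuous_fderiv (by simp))
  have hsupp : HasCompactSupport (gradient φ) :=
    (h2.fderiv (𝕜 := ℝ)).comp_left (g := (InnerProductSpace.toDual ℝ (E n)).symm) (map_zero _)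
  have hv : LocallyIntegrable v (volume.restrict Ω) := (Lp.memLp v).locallyIntegrable hs
  have hg := hv.integrable_smul_left_of_hasCompactSupport hc.norm hsupp.norm
  refine hg.mono ((Lp.aestronglyMeasurable v).inner hc.aestronglyMeasurable) ?_
  refine Eventually.of_forall fun x => ?_
  rw [norm_smul, norm_norm, mul_comm]
  exact norm_inner_le_norm (v x) (gradient φ x)

theorem integrable_mul_test {Ω : Set (E n)} {s : ℝ≥0∞} (hs : 1 ≤ s) (d : LpS Ω s)
    {φ : E n → ℝ} (h1 : ContDiff ℝ ∞ φ) (h2 : HasCompactSupport φ) :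
    Integrable (fun x => d x * φ x) (volume.restrict Ω) := by
  have hd : LocallyIntegrable d (volume.restrict Ω) := (Lp.memLp d).locallyIntegrable hs
  exact hd.integrable_smul_right_of_hasCompactSupport h1.continuous h2

theorem HasWeakDiv.zero (Ω : Set (E n)) (s : ℝ≥0∞) :
    HasWeakDiv Ω ((0 : LpV Ω s) : E n → E n) ((0 : LpS Ω s) : E n → ℝ) := by
  intro φ _ _ _
  have e1 : ∫ x in Ω, ⟪(0 : LpV Ω s) x, gradient φ x⟫ = 0 := by
    refine integral_eq_zero_of_ae ?_
    filter_upwards [Lp.coeFn_zero (E n) s (volume.restrict Ω)] with x hx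
    rw [hx]; simp
  have e2 : ∫ x in Ω, (0 : LpS Ω s) x * φ x = 0 := by
    refine integral_eq_zero_of_ae ?_
    filter_upwards [Lp.coeFn_zero ℝ s (volume.restrict Ω)] with x hx
    rw [hx]; simp
  rw [e1, e2, neg_zero]

theorem HasWeakDiv.add {Ω : Set (E n)} {s : ℝ≥0∞} (hs : 1 ≤ s) {v w : LpV Ω s} {d e : LpS Ω s}
    (h : HasWeakDiv Ω v d) (h' : HasWeakDiv Ω w e) :
    HasWeakDiv Ω (v + w : LpV Ω s) (d + e : LpS Ω s) := by
  intro φ h1 h2 h3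
  have e1 : ∫ x in Ω, ⟪(v + w : LpV Ω s) x, gradient φ x⟫ =
      ∫ x in Ω, (⟪v x, gradient φ x⟫ + ⟪w x, gradient φ x⟫) := by
    refine integral_congr_ae ?_
    filter_upwards [Lp.coeFn_add v w] with x hx
    rw [hx, Pi.add_apply, inner_add_left]
  have e2 : ∫ x in Ω, (d + e : LpS Ω s) x * φ x = ∫ x in Ω, (d x * φ x + e x * φ x) := by
    refine integral_congr_ae ?_
    filter_upwards [Lp.coeFn_add d e] with x hx
    rw [hx, Pi.add_apply, add_mul]
  rw [e1, e2, integral_add (integrable_inner_gradient hs v h1 h2)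
    (integrable_inner_gradient hs w h1 h2), integral_add (integrable_mul_test hs d h1 h2)
    (integrable_mul_test hs e h1 h2), h φ h1 h2 h3, h' φ h1 h2 h3, neg_add]

theorem HasWeakDiv.smul {Ω : Set (E n)} {s : ℝ≥0∞} {v : LpV Ω s} {d : LpS Ω s} (c : ℝ)
    (h : HasWeakDiv Ω v d) : HasWeakDiv Ω (c • v : LpV Ω s) (c • d : LpS Ω s) := by
  intro φ h1 h2 h3
  have e1 : ∫ x in Ω, ⟪(c • v : LpV Ω s) x, gradient φ x⟫ =
      ∫ x in Ω, c * ⟪v x, gradient φ x⟫ := by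
    refine integral_congr_ae ?_
    filter_upwards [Lp.coeFn_smul c v] with x hx
    rw [hx, Pi.smul_apply, real_inner_smul_left]
  have e2 : ∫ x in Ω, (c • d : LpS Ω s) x * φ x = ∫ x in Ω, c * (d x * φ x) := by
    refine integral_congr_ae ?_
    filter_upwards [Lp.coeFn_smul c d] with x hx
    rw [hx, Pi.smul_apply, smul_eq_mul, mul_assoc]
  rw [e1, e2, integral_const_mul, integral_const_mul, h φ h1 h2 h3, mul_neg]

/-- The weak divergence is unique. -/
theorem HasWeakDiv.unique {Ω : Set (E n)} (hΩ : IsOpen Ω) {s : ℝ≥0∞} (hs : 1 ≤ s)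
    {v : E n → E n} {d e : LpS Ω s} (h : HasWeakDiv Ω v d) (h' : HasWeakDiv Ω v e) : d = e := by
  have key := hΩ.ae_eq_zero_of_integral_contDiff_smul_eq_zero (μ := volume.restrict Ω)
    (f := fun x => d x - e x)
    ((((Lp.memLp d).locallyIntegrable hs).sub
      ((Lp.memLp e).locallyIntegrable hs)).locallyIntegrableOn Ω) (by
    intro φ h1 h2 h3
    have hd := h φ h1 h2 h3
    rw [h' φ h1 h2 h3, neg_inj] at hd
    calc ∫ x in Ω, φ x • (d x - e x) = ∫ x in Ω, (d x * φ x - e x * φ x) := by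
          refine integral_congr_ae (Eventually.of_forall fun x => ?_)
          simp only [smul_eq_mul]; ring
      _ = 0 := by
          rw [integral_sub (integrable_mul_test hs d h1 h2) (integrable_mul_test hs e h1 h2), hd,
            sub_self])
  refine Lp.ext ?_
  filter_upwards [key, ae_restrict_mem hΩ.measurableSet] with x hx hxΩ
  exact sub_eq_zero.1 (hx hxΩ)

/-- `W^s(div; Ω)`: the fields in `(L^s(Ω))ⁿ` whose weak divergence is in `L^s(Ω)`. -/
def WDiv (Ω : Set (E n)) (s : ℝ≥0∞) [hs : Fact (1 ≤ s)] : Submodule ℝ (LpV Ω s) where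
  carrier := {v | ∃ d : LpS Ω s, HasWeakDiv Ω v d}
  zero_mem' := ⟨0, HasWeakDiv.zero Ω s⟩
  add_mem' := by
    rintro v w ⟨d, hd⟩ ⟨e, he⟩
    exact ⟨d + e, hd.add hs.out he⟩
  smul_mem' := by
    rintro c v ⟨d, hd⟩
    exact ⟨c • d, hd.smul c⟩

variable {Ω : Set (E n)} {s : ℝ≥0∞} [hs : Fact (1 ≤ s)]

/-- The weak divergence of an element of `W^s(div; Ω)`. -/
noncomputable def weakDiv (v : WDiv Ω s) : LpS Ω s := Classical.choose v.2

theorem weakDiv_spec (v : WDiv Ω s) : HasWeakDiv Ω (v : LpV Ω s) (weakDiv v) :=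
  Classical.choose_spec v.2

/-- The norm of `W^s(div; Ω)`, `(∫_Ω ∑ᵢ |vᵢ|^s + ∫_Ω |div v|^s)^{1/s}` (for `s < ∞`). -/
noncomputable def divNorm (v : WDiv Ω s) : ℝ :=
  ((∫ x in Ω, ∑ i, |(v : LpV Ω s) x i| ^ s.toReal) +
    ∫ x in Ω, |weakDiv v x| ^ s.toReal) ^ (1 / s.toReal)

/-- `G` is the continuous extension to `W^s(div; Ω)` of the linear form
`v ↦ ∫_{∂Ω} u (v · n) dσ` given on the restrictions to `Ω` of smooth compactly supported vector
fields of `ℝⁿ` (these restrictions are dense in `W^s(div; Ω)`). -/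
def IsBoundaryPairing (u : E n → ℝ) (G : WDiv Ω s →ₗ[ℝ] ℝ) : Prop :=
  (∃ C : ℝ, ∀ v, |G v| ≤ C * divNorm v) ∧
  ∀ (v : WDiv Ω s) (w : E n → E n), ContDiff ℝ ∞ w → HasCompactSupport w →
    (v : LpV Ω s) =ᵐ[volume.restrict Ω] w →
    G v = ∫ x, u x * ⟪w x, outerNormal Ω x⟫ ∂(surfaceMeasure Ω)

open Classical in
/-- `v ↦ ∫_{∂Ω} u (v · n) dσ` on `W^s(div; Ω)`, the normal trace `v · n` being understood by
continuous extension from smooth fields. The extension exists and is unique if `Ω` is bounded with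
`C¹` boundary and `u ∈ W^{1/s,r}(∂Ω)`, `1/s + 1/r = 1`. -/
noncomputable def boundaryPairing (Ω : Set (E n)) (s : ℝ≥0∞) [Fact (1 ≤ s)] (u : E n → ℝ) :
    WDiv Ω s →ₗ[ℝ] ℝ :=
  if h : ∃ G : WDiv Ω s →ₗ[ℝ] ℝ, IsBoundaryPairing u G then h.choose else 0

end Spaces

section Forms

variable {n : ℕ} {Ω : Set (E n)}

instance fact_one_le_three : Fact ((1 : ℝ≥0∞) ≤ 3) := ⟨by norm_num⟩

/-- `V = W³(div; Ω)`. -/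
abbrev V (Ω : Set (E n)) : Type := WDiv Ω 3

/-- `Q = L^{3/2}(Ω)`. -/
abbrev Q (Ω : Set (E n)) : Type := LpS Ω (3 / 2)

/-- `a(u,v) = ∫_Ω (α + β|u|) u · v`. -/
noncomputable def formA (α β : E n → ℝ) (u v : LpV Ω 3) : ℝ :=
  ∫ x in Ω, (α x + β x * ‖u x‖) * ⟪u x, v x⟫

/-- `b(v,q) = ∫_Ω div(v) q`. -/
noncomputable def formB (v : V Ω) (q : Q Ω) : ℝ :=
  ∫ x in Ω, weakDiv v x * q x

/-- `d_ε(u,v) = ε ∫_Ω |div u| div u div v`. -/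
noncomputable def formD (ε : ℝ) (u v : V Ω) : ℝ :=
  ε * ∫ x in Ω, |weakDiv u x| * weakDiv u x * weakDiv v x

/-- `c_ε(p,q) = ε ∫_Ω (p/√|p|) q`, the integrand being `0` where `p = 0`. -/
noncomputable def formC (ε : ℝ) (p q : Q Ω) : ℝ :=
  ε * ∫ x in Ω, p x / √|p x| * q x

/-- `g(v) = - ∫_{∂Ω} S_b (v · n) dσ`. -/
noncomputable def formG (Sb : E n → ℝ) (v : V Ω) : ℝ :=
  - boundaryPairing Ω 3 Sb v

/-- `f(q) = ∫_Ω f q`. -/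
noncomputable def formF (f : LpS Ω 3) (q : Q Ω) : ℝ :=
  ∫ x in Ω, f x * q x

/-- `(m, S) ∈ V × Q` solves the regularized stationary mixed problem. -/
def IsRegularizedSolution (α β : E n → ℝ) (f : LpS Ω 3) (Sb : E n → ℝ) (ε : ℝ)
    (m : V Ω) (S : Q Ω) : Prop :=
  (∀ v : V Ω, formA α β (m : LpV Ω 3) (v : LpV Ω 3) + formD ε m v - formB v S = formG Sb v) ∧
  (∀ q : Q Ω, formC ε S q + formB m q = formF f q)

end Forms

end DarcyForchheimer

/-! The scalar map `p ↦ p/√|p|` is a bijection with inverse `r ↦ |r| r`, so the second equation says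
exactly that `S = ε⁻² |f - div m| (f - div m)` almost everywhere (`forall_formC_add_formB_iff`).
Substituting this into the first leaves one equation for `m`: stationarity of the convex energy `∫
α|v|²/2 + β|v|³/3 + (ε/3) ∫ |div v|³ + (ε⁻²/3) ∫ |f - div v|³` minus the boundary form.

The function `|·|³/3` is uniformly convex with a cubic modulus (`norm_pow_three_convex`), so the
energy has such a modulus in the norm of `V` (`reducedEnergy_convex`). Minimizing sequences are
therefore Cauchy, and completeness replaces weak compactness; the same modulus gives uniqueness
(`existsUnique_eq_of_cubic_modulus`). The Banach space used is the graph of the divergence in `L³ ×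
L³`, which is closed (`isClosed_divGraph`). No inf-sup condition is needed, and the boundary term
enters only as a bounded linear form. -/

namespace DarcyForchheimer

/-! ### Minimization of functions with a cubic modulus of convexity -/

section Abstract

variable {X : Type*} [NormedAddCommGroup X] [NormedSpace ℝ X]

/-- A function with subgradients `A w` and a cubic modulus of convexity is bounded below. -/
theorem bddBelow_of_cubic_modulus {J : X → ℝ} {A : X → X →L[ℝ] ℝ} {c : ℝ} (hc : 0 < c)
    (h1 : ∀ w w', J w + A w (w' - w) + c * ‖w' - w‖ ^ 3 ≤ J w') : BddBelow (Set.range J) := by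
  -- With `M = ‖A 0‖`, the bound `c r³ - M r` is negative only if `r² < M / c`, and then `r ≤ 1 + r²
  -- ≤ 1 + M / c`.
  refine ⟨J 0 - ‖A 0‖ * (1 + ‖A 0‖ / c), ?_⟩
  rintro _ ⟨w, rfl⟩
  have h := h1 0 w
  rw [sub_zero] at h
  have hA : -(‖A 0‖ * ‖w‖) ≤ A 0 w := neg_le_of_abs_le ((A 0).le_opNorm w)
  have hr := norm_nonneg w
  have hM := norm_nonneg (A 0)
  generalize ‖w‖ = r at *
  generalize ‖A 0‖ = M at *
  have key : -(M * (1 + M / c)) ≤ c * r ^ 3 - M * r := by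
    have hMc : 0 ≤ M / c := by positivity
    by_cases hcr : M ≤ c * r ^ 2
    · have : 0 ≤ M * (1 + M / c) := by positivity
      nlinarith [mul_nonneg hr (sub_nonneg.2 hcr)]
    · have h2 : r ^ 2 ≤ M / c := by
        rw [le_div_iff₀ hc]; linarith
      have h3 : r ≤ 1 + M / c := by nlinarith [sq_nonneg (r - 1)]
      have h4 : 0 ≤ c * r ^ 3 := by positivity
      nlinarith [mul_le_mul_of_nonneg_left h3 hM]
  linarith

/-- The midpoint inequality that a cubic modulus of convexity gives. -/
theorem norm_sub_pow_three_le_of_cubic_modulus {J : X → ℝ} {A : X → X →L[ℝ] ℝ} {c : ℝ}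
    (h1 : ∀ w w', J w + A w (w' - w) + c * ‖w' - w‖ ^ 3 ≤ J w') {I : ℝ} (hI : ∀ w, I ≤ J w)
    (u v : X) : c / 4 * ‖u - v‖ ^ 3 ≤ J u + J v - 2 * I := by
  set m : X := (2⁻¹ : ℝ) • (u + v) with hm
  have hu : u - m = (2⁻¹ : ℝ) • (u - v) := by rw [hm]; module
  have hv : v - m = -((2⁻¹ : ℝ) • (u - v)) := by rw [hm]; module
  -- The linear terms at the midpoint cancel in the sum; the two cubes give `2 c (1/2)³ = c / 4`.
  have e1 := h1 m u
  have e2 := h1 m v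
  rw [hu, norm_smul] at e1
  rw [hv, norm_neg, norm_smul, map_neg] at e2
  have := hI m
  norm_num at e1 e2
  nlinarith

/-- A function with subgradients `A w` and a cubic modulus of convexity attains its minimum. -/
theorem exists_forall_le_of_cubic_modulus [CompleteSpace X] {J : X → ℝ} {A : X → X →L[ℝ] ℝ}
    {c : ℝ} (hc : 0 < c) (h1 : ∀ w w', J w + A w (w' - w) + c * ‖w' - w‖ ^ 3 ≤ J w') :
    ∃ w, ∀ w', J w ≤ J w' := by
  have hb := bddBelow_of_cubic_modulus hc h1
  set I := ⨅ w, J w with hIdef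
  have hI : ∀ w, I ≤ J w := fun w => ciInf_le hb w
  have hex : ∀ k : ℕ, ∃ u, J u < I + 1 / ((k : ℝ) + 1) := fun k =>
    exists_lt_of_ciInf_lt (by rw [← hIdef]; exact lt_add_of_pos_right _ (by positivity))
  choose u hu using hex
  have hcau : CauchySeq u := by
    refine Metric.cauchySeq_iff'.2 fun ε hε => ?_
    obtain ⟨N, hN⟩ := exists_nat_one_div_lt (show (0 : ℝ) < c * ε ^ 3 / 8 by positivity)
    refine ⟨N, fun k hk => ?_⟩
    rw [dist_eq_norm]
    by_contra! hle
    have h2 := norm_sub_pow_three_le_of_cubic_modulus h1 hI (u k) (u N)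
    have h3 : ε ^ 3 ≤ ‖u k - u N‖ ^ 3 := by gcongr
    have h4 : 1 / ((k : ℝ) + 1) ≤ 1 / ((N : ℝ) + 1) := by gcongr
    have h5 := hu k
    have h6 := hu N
    nlinarith [mul_le_mul_of_nonneg_left h3 hc.le]
  obtain ⟨w, hw⟩ := cauchySeq_tendsto_of_complete hcau
  refine ⟨w, fun w' => le_trans ?_ (hI w')⟩
  -- Continuity of `J` is not needed: the subgradient at the limit `w` bounds `J w` by `J (u k)` up
  -- to a vanishing linear term.
  have t1 : Tendsto (fun k => J w + A w (u k - w)) atTop (𝓝 (J w + A w (w - w))) :=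
    (((A w).continuous.tendsto _).comp (hw.sub_const w)).const_add _
  have t2 : Tendsto (fun k : ℕ => I + 1 / ((k : ℝ) + 1)) atTop (𝓝 (I + 0)) :=
    tendsto_one_div_add_atTop_nhds_zero_nat.const_add _
  rw [sub_self, map_zero, add_zero] at t1
  rw [add_zero] at t2
  refine le_of_tendsto_of_tendsto' t1 t2 fun k => ?_
  have h2 := h1 w (u k)
  have h3 : 0 ≤ c * ‖u k - w‖ ^ 3 := by positivity
  linarith [hu k]

/-- If `A w` is the hemicontinuous derivative of a function with a cubic modulus of convexity,
then `A w = G` has exactly one solution. -/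
theorem existsUnique_eq_of_cubic_modulus [CompleteSpace X] {J : X → ℝ} {A : X → X →L[ℝ] ℝ}
    {c : ℝ} (hc : 0 < c) (h1 : ∀ w w', J w + A w (w' - w) + c * ‖w' - w‖ ^ 3 ≤ J w')
    (h2 : ∀ w h, Tendsto (fun t : ℝ => A (w + t • h) h) (𝓝[>] 0) (𝓝 (A w h)))
    (G : X →L[ℝ] ℝ) : ∃! w, A w = G := by
  have h1' : ∀ w w', (J w - G w) + (A w - G) (w' - w) + c * ‖w' - w‖ ^ 3 ≤ J w' - G w' := by
    intro w w'
    have := h1 w w'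
    rw [sub_apply, map_sub G]
    linarith
  obtain ⟨w, hw⟩ := exists_forall_le_of_cubic_modulus (J := fun w => J w - G w) hc h1'
  have hpos : ∀ h, G h ≤ A w h := by
    intro h
    -- The subgradient is taken at the perturbed point `w + t • h` and compared with the minimum at
    -- `w`; hemicontinuity then lets `t → 0`.
    refine ge_of_tendsto (h2 w h) ?_
    filter_upwards [self_mem_nhdsWithin] with t (ht : 0 < t)
    have e1 := h1' (w + t • h) w
    have e2 := hw (w + t • h)
    have e3 : w - (w + t • h) = -(t • h) := by abel
    rw [e3, norm_neg, map_neg, map_smul, smul_eq_mul, sub_apply] at e1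
    have e4 : 0 ≤ c * ‖t • h‖ ^ 3 := by positivity
    have e5 : 0 ≤ t * (A (w + t • h) h - G h) := by linarith
    linarith [nonneg_of_mul_nonneg_right e5 ht]
  refine ⟨w, ?_, fun w' hw' => ?_⟩
  · ext h
    have := hpos (-h)
    rw [map_neg, map_neg] at this
    linarith [hpos h]
  · have e1 := h1' w' w
    have e2 := hw w'
    rw [show A w' = G from hw', sub_self, zero_apply] at e1
    have e3 : ‖w - w'‖ ^ 3 ≤ 0 := by
      by_contra! h
      nlinarith [mul_pos hc h]
    have e4 : ‖w - w'‖ = 0 := by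
      by_contra h
      have : 0 < ‖w - w'‖ := lt_of_le_of_ne (norm_nonneg _) (Ne.symm h)
      exact absurd e3 (not_le.2 (by positivity))
    exact (sub_eq_zero.1 (norm_eq_zero.1 e4)).symm

end Abstract

/-! ### Pointwise convexity inequalities -/

section Pointwise

variable {H : Type*} [NormedAddCommGroup H] [InnerProductSpace ℝ H]

/-- Uniform convexity of `‖·‖ ^ 3 / 3` in an inner product space. -/
theorem norm_pow_three_convex (a b : H) :
    ‖a‖ ^ 3 / 3 + ‖a‖ * ⟪a, b - a⟫ + ‖b - a‖ ^ 3 / 16 ≤ ‖b‖ ^ 3 / 3 := by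
  have hd : ‖b - a‖ ^ 2 = ‖b‖ ^ 2 - 2 * ⟪b, a⟫ + ‖a‖ ^ 2 := norm_sub_sq_real b a
  rw [real_inner_comm] at hd
  have hi : ⟪a, b - a⟫ = ⟪a, b⟫ - ‖a‖ ^ 2 := by
    rw [inner_sub_right, real_inner_self_eq_norm_sq]
  have hle : ‖b - a‖ ≤ ‖b‖ + ‖a‖ := norm_sub_le b a
  rw [hi]
  have hx := norm_nonneg a
  have hy := norm_nonneg b
  have hz := norm_nonneg (b - a)
  generalize ‖b - a‖ = d at *
  generalize ‖a‖ = x at *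
  generalize ‖b‖ = y at *
  generalize ⟪a, b⟫ = s at *
  have hs : s = (x ^ 2 + y ^ 2 - d ^ 2) / 2 := by linarith
  subst hs
  -- The right side is the exact convexity gap once the inner product is eliminated. If `y ≤ 3x`,
  -- then `d ≤ 4x` and the last term suffices; otherwise `d ≤ 4y/3`, and both sides compare with
  -- `4y³/27`.
  have key : d ^ 3 / 16 ≤ (y - x) ^ 2 * (2 * y + x) / 6 + x * d ^ 2 / 2 := by
    by_cases hxy : y ≤ 3 * x
    · have h1 : d ^ 2 * d ≤ d ^ 2 * (4 * x) :=
        mul_le_mul_of_nonneg_left (by linarith) (sq_nonneg d)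
      have h2 : 0 ≤ (y - x) ^ 2 * (2 * y + x) := by positivity
      have h3 : 0 ≤ x * d ^ 2 := by positivity
      nlinarith
    · push Not at hxy
      have h1 : d ^ 3 ≤ (y + x) ^ 3 := by gcongr
      have h2 : (y + x) ^ 3 ≤ (4 / 3 * y) ^ 3 := by gcongr; linarith
      have h3 : (2 / 3 * y) ^ 2 ≤ (y - x) ^ 2 := by gcongr; linarith
      have h4 : (2 / 3 * y) ^ 2 * (2 * y) ≤ (y - x) ^ 2 * (2 * y + x) := by gcongr; linarith
      have h5 : 0 ≤ x * d ^ 2 := by positivity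
      nlinarith
  nlinarith

/-- Convexity of `‖·‖ ^ 2 / 2` in an inner product space. -/
theorem norm_sq_convex (a b : H) : ‖a‖ ^ 2 / 2 + ⟪a, b - a⟫ ≤ ‖b‖ ^ 2 / 2 := by
  have hd : ‖b - a‖ ^ 2 = ‖b‖ ^ 2 - 2 * ⟪b, a⟫ + ‖a‖ ^ 2 := norm_sub_sq_real b a
  rw [real_inner_comm] at hd
  rw [inner_sub_right, real_inner_self_eq_norm_sq]
  nlinarith [sq_nonneg ‖b - a‖]

end Pointwise

/-! ### The Darcy–Forchheimer flux and its energy on `L³` -/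

section Flux

theorem real_inner_eq_mul (x y : ℝ) : ⟪x, y⟫ = x * y := mul_comm _ _

instance fact_one_le_three_halves : Fact ((1 : ℝ≥0∞) ≤ 3 / 2) :=
  ⟨by rw [ENNReal.le_div_iff_mul_le] <;> norm_num⟩

instance holderTriple_three_three : ENNReal.HolderTriple 3 3 (3 / 2) where
  inv_add_inv_eq_inv := by
    rw [ENNReal.inv_div (by simp) (by simp), ENNReal.div_eq_inv_mul, mul_two]

instance holderConjugate_three_halves_three : ENNReal.HolderConjugate (3 / 2) 3 where
  inv_add_inv_eq_inv := by
    rw [ENNReal.inv_div (by simp) (by simp), inv_one, ← one_div, ENNReal.div_add_div_same]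
    norm_num
    exact ENNReal.div_self (by norm_num) (by norm_num)

variable {T : Type*} [MeasurableSpace T] {μ : Measure T}
  {H : Type*} [NormedAddCommGroup H]

theorem norm_Lp_three_pow (v : Lp H 3 μ) : ‖v‖ ^ 3 = ∫ x, ‖v x‖ ^ 3 ∂μ := by
  have h0 : 0 ≤ ∫ x, ‖v x‖ ^ 3 ∂μ := integral_nonneg fun x => by positivity
  have h := (Lp.memLp v).eLpNorm_eq_integral_rpow_norm (by norm_num) (by norm_num)
  simp only [ENNReal.toReal_ofNat, Real.rpow_ofNat] at h
  rw [Lp.norm_def, h, ENNReal.toReal_ofReal (by positivity), ← Real.rpow_natCast,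
    ← Real.rpow_mul h0]
  norm_num

theorem integrable_norm_pow_three {v : T → H} (hv : MemLp v 3 μ) :
    Integrable (fun x => ‖v x‖ ^ 3) μ := by
  simpa using hv.integrable_norm_pow (p := 3) (by norm_num)

theorem integrable_norm_pow_two [IsFiniteMeasure μ] {v : T → H} (hv : MemLp v 3 μ) :
    Integrable (fun x => ‖v x‖ ^ 2) μ := by
  have h2 : MemLp v 2 μ := hv.mono_exponent (by norm_num)
  simpa using h2.integrable_norm_pow (p := 2) (by norm_num)

/-- The energy `∫ a|v|²/2 + b|v|³/3`. -/
noncomputable def energy (μ : Measure T) (a b : T → ℝ) (v : T → H) : ℝ :=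
  ∫ x, (a x * (‖v x‖ ^ 2 / 2) + b x * (‖v x‖ ^ 3 / 3)) ∂μ

theorem integrable_energy [IsFiniteMeasure μ] {a b : T → ℝ} (ha : MemLp a ⊤ μ) (hb : MemLp b ⊤ μ) {v : T → H}
    (hv : MemLp v 3 μ) :
    Integrable (fun x => a x * (‖v x‖ ^ 2 / 2) + b x * (‖v x‖ ^ 3 / 3)) μ :=
  (((integrable_norm_pow_two hv).div_const 2).mul_of_top_right ha).add
    (((integrable_norm_pow_three hv).div_const 3).mul_of_top_right hb)

variable [InnerProductSpace ℝ H] [IsFiniteMeasure μ]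

/-- On a finite measure space `a` and `b|v|` both lie in `L³`, and a product of two `L³` functions
is in `L^{3/2}`, the dual exponent of `3`. -/
theorem memLp_flux {a b : T → ℝ} (ha : MemLp a ⊤ μ) (hb : MemLp b ⊤ μ) {v : T → H}
    (hv : MemLp v 3 μ) : MemLp (fun x => (a x + b x * ‖v x‖) • v x) (3 / 2) μ := by
  have h1 : MemLp a 3 μ := ha.mono_exponent le_top
  have h2 : MemLp (fun x => b x * ‖v x‖) 3 μ := hv.norm.mul' (p := ⊤) (q := 3) hb
  exact hv.smul (p := 3) (q := 3) (h1.add h2)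

/-- The linear form `h ↦ ∫ (a + b|v|) v · h` on `L³`. -/
noncomputable def flux {a b : T → ℝ} (ha : MemLp a ⊤ μ) (hb : MemLp b ⊤ μ) (v : Lp H 3 μ) :
    Lp H 3 μ →L[ℝ] ℝ :=
  ContinuousLinearMap.lpPairing (𝕜 := ℝ) μ (3 / 2) 3 (innerSL ℝ : H →L[ℝ] H →L[ℝ] ℝ)
    ((memLp_flux ha hb (Lp.memLp v)).toLp _)

theorem flux_apply {a b : T → ℝ} (ha : MemLp a ⊤ μ) (hb : MemLp b ⊤ μ) (v h : Lp H 3 μ) :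
    flux ha hb v h = ∫ x, (a x + b x * ‖v x‖) * ⟪v x, h x⟫ ∂μ := by
  rw [flux, ContinuousLinearMap.lpPairing_eq_integral]
  refine integral_congr_ae ?_
  filter_upwards [(memLp_flux ha hb (Lp.memLp v)).coeFn_toLp] with x hx
  rw [hx]
  exact real_inner_smul_left _ _ _

theorem integrable_flux {a b : T → ℝ} (ha : MemLp a ⊤ μ) (hb : MemLp b ⊤ μ) {v h : T → H}
    (hv : MemLp v 3 μ) (hh : MemLp h 3 μ) :
    Integrable (fun x => (a x + b x * ‖v x‖) * ⟪v x, h x⟫) μ := by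
  have h1 := (hh.norm.mul' (p := 3 / 2) (q := 3) (r := 1) (memLp_flux ha hb hv).norm).integrable
    le_rfl
  refine h1.mono ?_ (Eventually.of_forall fun x => ?_)
  · exact (ha.1.add (hb.1.mul hv.1.norm)).mul (hv.1.inner hh.1)
  · rw [norm_mul, norm_mul, norm_norm, norm_norm, norm_smul, mul_assoc]
    gcongr
    exact norm_inner_le_norm _ _

/-- The pointwise inequalities are integrated: the quadratic part contributes only convexity, the
cubic part the whole modulus. -/
theorem energy_convex {a b : T → ℝ} (ha : MemLp a ⊤ μ) (hb : MemLp b ⊤ μ) {b₀ : ℝ}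
    (hb₀ : 0 ≤ b₀) (ha' : ∀ᵐ x ∂μ, 0 ≤ a x) (hb' : ∀ᵐ x ∂μ, b₀ ≤ b x) (v w : Lp H 3 μ) :
    energy μ a b v + flux ha hb v (w - v) + b₀ / 16 * ‖w - v‖ ^ 3 ≤ energy μ a b w := by
  have i1 := integrable_energy ha hb (Lp.memLp v)
  have i2 := integrable_flux ha hb (Lp.memLp v) (Lp.memLp (w - v))
  have i3 := (integrable_norm_pow_three (Lp.memLp (w - v))).const_mul (b₀ / 16)
  have i12 : Integrable (fun x => a x * (‖v x‖ ^ 2 / 2) + b x * (‖v x‖ ^ 3 / 3) +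
    (a x + b x * ‖v x‖) * ⟪v x, (w - v : Lp H 3 μ) x⟫) μ := i1.add i2
  rw [flux_apply, norm_Lp_three_pow, ← integral_const_mul, energy, energy, ← integral_add i1 i2,
    ← integral_add i12 i3]
  refine integral_mono_ae (i12.add i3) (integrable_energy ha hb (Lp.memLp w)) ?_
  filter_upwards [ha', hb', Lp.coeFn_sub w v] with x h1 h2 h3
  simp only [h3, Pi.sub_apply]
  have e1 := mul_le_mul_of_nonneg_left (norm_sq_convex (v x) (w x)) h1
  have e2 := mul_le_mul_of_nonneg_left (norm_pow_three_convex (v x) (w x)) (hb₀.trans h2)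
  have e3 := mul_le_mul_of_nonneg_right h2 (show 0 ≤ ‖w x - v x‖ ^ 3 / 16 by positivity)
  nlinarith

theorem tendsto_flux {a b : T → ℝ} (ha : MemLp a ⊤ μ) (hb : MemLp b ⊤ μ) (v h : Lp H 3 μ) :
    Tendsto (fun t : ℝ => flux ha hb (v + t • h) h) (𝓝[>] 0) (𝓝 (flux ha hb v h)) := by
  have e : ∀ t : ℝ, flux ha hb (v + t • h) h =
      ∫ x, (a x + b x * ‖v x + t • h x‖) * ⟪v x + t • h x, h x⟫ ∂μ := by
    intro t
    rw [flux_apply]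
    refine integral_congr_ae ?_
    filter_upwards [Lp.coeFn_add v (t • h), Lp.coeFn_smul t h] with x h1 h2
    rw [h1, Pi.add_apply, h2, Pi.smul_apply]
  simp only [e]
  rw [flux_apply]
  have hg : MemLp (fun x => ‖v x‖ + ‖h x‖) 3 μ := (Lp.memLp v).norm.add (Lp.memLp h).norm
  -- For `0 < t < 1` the integrand is dominated by the same expression formed with `‖v‖ + ‖h‖` and
  -- `‖h‖`, so `integrable_flux` covers it.
  refine tendsto_integral_filter_of_dominated_convergence
    (fun x => (‖a x‖ + ‖b x‖ * ‖(‖v x‖ + ‖h x‖)‖) * ⟪‖v x‖ + ‖h x‖, ‖h x‖⟫) ?_ ?_ ?_ ?_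
  · refine Eventually.of_forall fun t => ?_
    have hm : AEStronglyMeasurable (fun x => v x + t • h x) μ :=
      (Lp.aestronglyMeasurable v).add ((Lp.aestronglyMeasurable h).const_smul t)
    exact (ha.1.add (hb.1.mul hm.norm)).mul (hm.inner (Lp.aestronglyMeasurable h))
  · have ht1 : ∀ᶠ t : ℝ in 𝓝[>] 0, t < 1 := nhdsWithin_le_nhds (Iio_mem_nhds one_pos)
    filter_upwards [ht1, self_mem_nhdsWithin] with t h1 (h0 : 0 < t)
    refine Eventually.of_forall fun x => ?_
    have hn : ‖v x + t • h x‖ ≤ ‖v x‖ + ‖h x‖ := by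
      refine (norm_add_le _ _).trans ?_
      rw [norm_smul, Real.norm_of_nonneg h0.le]
      gcongr
      exact mul_le_of_le_one_left (norm_nonneg _) h1.le
    have hn0 : 0 ≤ ‖v x‖ + ‖h x‖ := by positivity
    rw [norm_mul, Real.norm_of_nonneg hn0, real_inner_eq_mul]
    refine mul_le_mul ?_ ?_ (norm_nonneg _) (by positivity)
    · refine (norm_add_le _ _).trans ?_
      rw [norm_mul, norm_norm]
      gcongr
    · refine (norm_inner_le_norm _ _).trans ?_
      gcongr
  · exact integrable_flux ha.norm hb.norm hg (Lp.memLp h).norm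
  · refine Eventually.of_forall fun x => ?_
    have hc : Continuous fun t : ℝ =>
        (a x + b x * ‖v x + t • h x‖) * ⟪v x + t • h x, h x⟫ := by fun_prop
    have := hc.tendsto 0
    simp only [zero_smul, add_zero] at this
    exact this.mono_left nhdsWithin_le_nhds

end Flux

/-! ### The graph of the divergence and the boundary form on it -/

section Graph

variable {n : ℕ} {Ω : Set (E n)}

/-- The graph of the weak divergence in `(L³(Ω))ⁿ × L³(Ω)`. -/
def divGraph (Ω : Set (E n)) : Submodule ℝ (LpV Ω 3 × LpS Ω 3) where
  carrier := {p | HasWeakDiv Ω p.1 p.2}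
  zero_mem' := HasWeakDiv.zero Ω 3
  add_mem' := fun h h' => HasWeakDiv.add (by norm_num) h h'
  smul_mem' := fun c _ h => HasWeakDiv.smul c h

theorem continuous_integral_inner {T : Type*} [MeasurableSpace T] {μ : Measure T}
    {H : Type*} [NormedAddCommGroup H] [InnerProductSpace ℝ H] {g : T → H}
    (hg : MemLp g (3 / 2) μ) : Continuous fun v : Lp H 3 μ => ∫ x, ⟪v x, g x⟫ ∂μ := by
  have h := (ContinuousLinearMap.lpPairing (𝕜 := ℝ) μ (3 / 2) 3
    (innerSL ℝ : H →L[ℝ] H →L[ℝ] ℝ) (hg.toLp g)).continuous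
  convert h using 2 with v
  rw [ContinuousLinearMap.lpPairing_eq_integral]
  refine integral_congr_ae ?_
  filter_upwards [hg.coeFn_toLp] with x hx
  rw [hx]
  exact real_inner_comm _ _

/-- Each test function imposes one closed condition, since it and its gradient lie in `L^{3/2}` and
pair continuously with `L³`. -/
theorem isClosed_divGraph (Ω : Set (E n)) :
    IsClosed (divGraph Ω : Set (LpV Ω 3 × LpS Ω 3)) := by
  have e : (divGraph Ω : Set (LpV Ω 3 × LpS Ω 3)) =
      ⋂ (φ : E n → ℝ) (_ : ContDiff ℝ ∞ φ) (_ : HasCompactSupport φ) (_ : tsupport φ ⊆ Ω),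
        {p | ∫ x in Ω, ⟪p.1 x, gradient φ x⟫ = - ∫ x in Ω, p.2 x * φ x} := by
    ext p
    simp only [Set.mem_iInter]
    exact Iff.rfl
  rw [e]
  refine isClosed_iInter fun φ => isClosed_iInter fun h1 => isClosed_iInter fun h2 =>
    isClosed_iInter fun _ => ?_
  have hc : Continuous (gradient φ) :=
    (InnerProductSpace.toDual ℝ (E n)).symm.continuous.comp (h1.continuous_fderiv (by simp))
  have hs : HasCompactSupport (gradient φ) :=
    (h2.fderiv (𝕜 := ℝ)).comp_left (g := (InnerProductSpace.toDual ℝ (E n)).symm) (map_zero _)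
  have c1 := continuous_integral_inner (μ := volume.restrict Ω)
    (hc.memLp_of_hasCompactSupport hs)
  have c2 := continuous_integral_inner (μ := volume.restrict Ω)
    (h1.continuous.memLp_of_hasCompactSupport h2)
  refine isClosed_eq (c1.comp continuous_fst) ?_
  have c3 := (c2.comp continuous_snd : Continuous fun p : LpV Ω 3 × LpS Ω 3 => _).neg
  refine c3.congr fun p => ?_
  refine congrArg Neg.neg (integral_congr_ae (Eventually.of_forall fun x => ?_))
  exact mul_comm _ _

theorem weakDiv_mk (hΩ : IsOpen Ω) {v : LpV Ω 3} {d : LpS Ω 3} (h : HasWeakDiv Ω v d) :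
    weakDiv (⟨v, d, h⟩ : V Ω) = d :=
  (weakDiv_spec (⟨v, d, h⟩ : V Ω)).unique hΩ (by norm_num) h

/-- `W³(div; Ω)` as seen from the graph of the weak divergence. -/
def ofDivGraph (Ω : Set (E n)) : divGraph Ω →ₗ[ℝ] V Ω where
  toFun p := ⟨p.1.1, p.1.2, p.2⟩
  map_add' _ _ := rfl
  map_smul' _ _ := rfl

/-- Each of the `n` components is bounded by `‖v‖` and the divergence adds one more term, whence `n
+ 1`. -/
theorem divNorm_le (v : V Ω) :
    divNorm v ≤ ((n : ℝ) + 1) ^ (1 / 3 : ℝ) * ‖((v : LpV Ω 3), weakDiv v)‖ := by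
  set M := ‖((v : LpV Ω 3), weakDiv v)‖
  have hM : 0 ≤ M := norm_nonneg _
  have h1 : ∫ x in Ω, ∑ i, |(v : LpV Ω 3) x i| ^ 3 ≤ n * M ^ 3 := by
    calc ∫ x in Ω, ∑ i, |(v : LpV Ω 3) x i| ^ 3
        ≤ ∫ x in Ω, n * ‖(v : LpV Ω 3) x‖ ^ 3 := by
          refine integral_mono_of_nonneg (Eventually.of_forall fun x => ?_)
            ((integrable_norm_pow_three (Lp.memLp (v : LpV Ω 3))).const_mul _)
            (Eventually.of_forall fun x => ?_)
          · exact Finset.sum_nonneg fun i _ => by positivity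
          · calc ∑ i, |(v : LpV Ω 3) x i| ^ 3 ≤ ∑ _i : Fin n, ‖(v : LpV Ω 3) x‖ ^ 3 := by
                  gcongr with i
                  exact PiLp.norm_apply_le ((v : LpV Ω 3) x) i
              _ = n * ‖(v : LpV Ω 3) x‖ ^ 3 := by simp
      _ = n * ‖(v : LpV Ω 3)‖ ^ 3 := by rw [integral_const_mul, norm_Lp_three_pow]
      _ ≤ n * M ^ 3 := by gcongr; exact norm_fst_le ((v : LpV Ω 3), weakDiv v)
  have h2 : ∫ x in Ω, |weakDiv v x| ^ 3 ≤ M ^ 3 := by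
    have := norm_Lp_three_pow (weakDiv v)
    simp only [Real.norm_eq_abs (weakDiv v _)] at this
    rw [← this]
    gcongr
    exact norm_snd_le ((v : LpV Ω 3), weakDiv v)
  rw [divNorm]
  simp only [ENNReal.toReal_ofNat, Real.rpow_ofNat]
  have h0 : 0 ≤ (∫ x in Ω, ∑ i, |(v : LpV Ω 3) x i| ^ 3) + ∫ x in Ω, |weakDiv v x| ^ 3 :=
    add_nonneg (integral_nonneg fun x => Finset.sum_nonneg fun i _ => by positivity)
      (integral_nonneg fun x => by positivity)
  calc _ ≤ (((n : ℝ) + 1) * M ^ 3) ^ (1 / 3 : ℝ) := by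
        refine Real.rpow_le_rpow h0 ?_ (by norm_num)
        linarith
    _ = _ := by
        rw [Real.mul_rpow (by positivity) (by positivity), ← Real.rpow_natCast M,
          ← Real.rpow_mul hM]
        norm_num

/-- Boundedness is part of `IsBoundaryPairing`, and the default value is the zero form. -/
theorem boundaryPairing_bounded (Ω : Set (E n)) (u : E n → ℝ) :
    ∃ C : ℝ, ∀ v : V Ω, |boundaryPairing Ω 3 u v| ≤ C * divNorm v := by
  unfold boundaryPairing
  split_ifs with h
  · exact h.choose_spec.1
  · exact ⟨0, fun v => by simp⟩

/-- `v ↦ - ∫_{∂Ω} u (v · n) dσ` as a continuous linear form on the graph of the divergence. -/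
theorem exists_clm_eq_formG (hΩ : IsOpen Ω) (u : E n → ℝ) :
    ∃ G : divGraph Ω →L[ℝ] ℝ, ∀ p, G p = formG u (ofDivGraph Ω p) := by
  obtain ⟨C, hC⟩ := boundaryPairing_bounded Ω u
  refine ⟨LinearMap.mkContinuous (-(boundaryPairing Ω 3 u ∘ₗ ofDivGraph Ω))
    (|C| * ((n : ℝ) + 1) ^ (1 / 3 : ℝ)) fun p => ?_, fun p => rfl⟩
  have h1 := divNorm_le (ofDivGraph Ω p)
  have e : weakDiv (ofDivGraph Ω p) = p.1.2 := weakDiv_mk hΩ p.2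
  rw [e] at h1
  rw [LinearMap.neg_apply, norm_neg, LinearMap.comp_apply, Real.norm_eq_abs]
  refine (hC _).trans ?_
  have h0 : 0 ≤ divNorm (ofDivGraph Ω p) := by
    unfold divNorm
    exact Real.rpow_nonneg (add_nonneg
      (integral_nonneg fun x => Finset.sum_nonneg fun i _ => by positivity)
      (integral_nonneg fun x => by positivity)) _
  calc C * divNorm (ofDivGraph Ω p) ≤ |C| * divNorm (ofDivGraph Ω p) := by
        gcongr; exact le_abs_self C
    _ ≤ |C| * (((n : ℝ) + 1) ^ (1 / 3 : ℝ) * ‖p‖) := by gcongr; exact h1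
    _ = _ := (mul_assoc _ _ _).symm

end Graph

/-! ### Elimination of `S` -/

section Elimination

theorem mul_div_sqrt_abs_eq_iff {ε : ℝ} (hε : 0 < ε) (p r : ℝ) :
    ε * (p / √|p|) = r ↔ p = (ε ^ 2)⁻¹ * |r| * r := by
  have hε' := hε.ne'
  constructor
  · rintro rfl
    rcases eq_or_ne p 0 with rfl | hp
    · simp
    · have hs : 0 < √|p| := Real.sqrt_pos.2 (abs_pos.2 hp)
      have hsq : √|p| ^ 2 = |p| := Real.sq_sqrt (abs_nonneg p)
      rw [abs_mul, abs_div, abs_of_pos hε, abs_of_pos hs, ← hsq]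
      field_simp
      rw [hsq, hsq]
  · rintro rfl
    have e : √|(ε ^ 2)⁻¹ * |r| * r| = |r| / ε := by
      rw [show |(ε ^ 2)⁻¹ * |r| * r| = (|r| / ε) ^ 2 by
        rw [abs_mul, abs_mul, abs_abs, abs_inv, abs_of_pos (by positivity : 0 < ε ^ 2)]
        field_simp]
      exact Real.sqrt_sq (by positivity)
    rw [e]
    rcases eq_or_ne r 0 with rfl | hr
    · simp
    · have := abs_pos.2 hr
      field_simp

/-- The modulus of the function is `√|p|`, whose cube is `|p|^{3/2}`. -/
theorem memLp_div_sqrt_abs {T : Type*} [MeasurableSpace T] {μ : Measure T} {p : T → ℝ}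
    (hp : MemLp p (3 / 2) μ) : MemLp (fun x => p x / √|p x|) 3 μ := by
  have h := hp.norm_rpow_div (1 / 2)
  have e : (3 / 2 / (1 / 2) : ℝ≥0∞) = 3 := by
    rw [one_div, div_eq_mul_inv, inv_inv]
    exact ENNReal.div_mul_cancel (by norm_num) (by norm_num)
  rw [e] at h
  refine h.of_le ?_ (Eventually.of_forall fun x => ?_)
  · exact (hp.1.aemeasurable.div
      (Real.continuous_sqrt.measurable.comp_aemeasurable
        (continuous_abs.measurable.comp_aemeasurable hp.1.aemeasurable))).aestronglyMeasurable
  · rw [norm_div, Real.norm_of_nonneg (Real.sqrt_nonneg _), Real.norm_eq_abs (p x),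
      Real.div_sqrt, Real.norm_of_nonneg (by positivity), Real.sqrt_eq_rpow]
    simp

theorem integrable_mul_three {T : Type*} [MeasurableSpace T] {μ : Measure T} {d q : T → ℝ}
    (hd : MemLp d 3 μ) (hq : MemLp q (3 / 2) μ) : Integrable (fun x => d x * q x) μ :=
  memLp_one_iff_integrable.1 (hq.mul' (p := 3) (q := 3 / 2) hd)

theorem ae_eq_zero_of_forall_integral_mul {T : Type*} [MeasurableSpace T] {μ : Measure T}
    [IsFiniteMeasure μ] {z : T → ℝ} (hz : MemLp z 3 μ)
    (h : ∀ q : Lp ℝ (3 / 2) μ, ∫ x, z x * q x ∂μ = 0) : z =ᵐ[μ] 0 := by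
  -- The test function is `|z| z`, which turns the hypothesis into `∫ |z|³ = 0`.
  have hq := memLp_flux (a := fun _ : T => (0 : ℝ)) (b := fun _ => 1) (memLp_top_const 0)
    (memLp_top_const 1) hz
  have h1 := h (hq.toLp _)
  have h2 : ∫ x, ‖z x‖ ^ 3 ∂μ = 0 := by
    rw [← h1]
    refine integral_congr_ae ?_
    filter_upwards [hq.coeFn_toLp] with x hx
    rw [hx, zero_add, one_mul, smul_eq_mul, Real.norm_eq_abs]
    calc |z x| ^ 3 = |z x| * |z x| ^ 2 := by ring
      _ = z x * (|z x| * z x) := by rw [sq_abs]; ring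
  rw [integral_eq_zero_iff_of_nonneg (fun x => by positivity)
    (integrable_norm_pow_three hz)] at h2
  filter_upwards [h2] with x hx
  simpa using hx

variable {n : ℕ} {Ω : Set (E n)}

/-- The second equation of the regularized problem determines `S` pointwise. -/
theorem forall_formC_add_formB_iff [IsFiniteMeasure (volume.restrict Ω)] {ε : ℝ} (hε : 0 < ε)
    (f : LpS Ω 3) (m : V Ω) (S : Q Ω) :
    (∀ q : Q Ω, formC ε S q + formB m q = formF f q) ↔
      ∀ᵐ x ∂(volume.restrict Ω),
        S x = (0 + (ε ^ 2)⁻¹ * ‖(f - weakDiv m) x‖) • (f - weakDiv m) x := by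
  have hS := memLp_div_sqrt_abs (Lp.memLp S)
  have hd := Lp.memLp (weakDiv m)
  have hf := Lp.memLp f
  have key : ∀ q : Q Ω, formC ε S q + formB m q - formF f q =
      ∫ x in Ω, (ε * (S x / √|S x|) + weakDiv m x - f x) * q x := by
    intro q
    have i1 := (integrable_mul_three hS (Lp.memLp q)).const_mul ε
    have i2 := integrable_mul_three hd (Lp.memLp q)
    have i3 := integrable_mul_three hf (Lp.memLp q)
    have i12 : Integrable (fun x => ε * (S x / √|S x| * q x) + weakDiv m x * q x)
      (volume.restrict Ω) := i1.add i2
    rw [formC, formB, formF, ← integral_const_mul, ← integral_add i1 i2, ← integral_sub i12 i3]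
    congr 1
    ext x
    ring
  have hz : MemLp (fun x => ε * (S x / √|S x|) + weakDiv m x - f x) 3 (volume.restrict Ω) :=
    ((hS.const_mul ε).add hd).sub hf
  -- The summand `0` makes the formula literally a flux with `a = 0` and `b = ε⁻²`.
  have pw : ∀ᵐ x ∂(volume.restrict Ω),
      ε * (S x / √|S x|) + weakDiv m x - f x = 0 ↔
        S x = (0 + (ε ^ 2)⁻¹ * ‖(f - weakDiv m) x‖) • (f - weakDiv m) x := by
    filter_upwards [Lp.coeFn_sub f (weakDiv m)] with x hx
    rw [hx, zero_add, smul_eq_mul, Real.norm_eq_abs, Pi.sub_apply,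
      ← mul_div_sqrt_abs_eq_iff hε]
    constructor <;> intro h <;> linarith
  constructor
  · intro h
    filter_upwards [pw, ae_eq_zero_of_forall_integral_mul hz fun q => by
      rw [← key, h, sub_self]] with x h1 h2
    exact h1.1 h2
  · intro h q
    rw [← sub_eq_zero, key]
    refine integral_eq_zero_of_ae ?_
    filter_upwards [pw, h] with x h1 h2
    rw [h1.2 h2]
    simp

end Elimination

/-! ### The reduced problem for `m` -/

section ReducedProblem

variable {n : ℕ} {Ω : Set (E n)} [IsFiniteMeasure (volume.restrict Ω)] {α β : E n → ℝ}

/-- The form `(v, d), (h, k) ↦ ∫ (α + β|v|) v · h + ε ∫ |d| d k - ε⁻² ∫ |f - d| (f - d) k`. -/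
noncomputable def reducedForm (hα : MemLp α ⊤ (volume.restrict Ω))
    (hβ : MemLp β ⊤ (volume.restrict Ω)) (f : LpS Ω 3) (ε : ℝ) (p : LpV Ω 3 × LpS Ω 3) :
    LpV Ω 3 × LpS Ω 3 →L[ℝ] ℝ :=
  flux hα hβ p.1 ∘L ContinuousLinearMap.fst ℝ _ _ +
    (flux (memLp_top_const 0) (memLp_top_const ε) p.2 -
      flux (memLp_top_const 0) (memLp_top_const (ε ^ 2)⁻¹) (f - p.2)) ∘L
      ContinuousLinearMap.snd ℝ _ _

/-- The convex function whose derivative is `reducedForm`. -/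
noncomputable def reducedEnergy (α β : E n → ℝ) (f : LpS Ω 3) (ε : ℝ)
    (p : LpV Ω 3 × LpS Ω 3) : ℝ :=
  energy (volume.restrict Ω) α β p.1 +
    energy (volume.restrict Ω) (fun _ => 0) (fun _ => ε) p.2 +
    energy (volume.restrict Ω) (fun _ => 0) (fun _ => (ε ^ 2)⁻¹) (f - p.2 : LpS Ω 3)

variable (hα : MemLp α ⊤ (volume.restrict Ω)) (hβ : MemLp β ⊤ (volume.restrict Ω))
  (f : LpS Ω 3) {ε : ℝ}

theorem reducedForm_apply (p h : LpV Ω 3 × LpS Ω 3) :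
    reducedForm hα hβ f ε p h = flux hα hβ p.1 h.1 +
      (flux (memLp_top_const 0) (memLp_top_const ε) p.2 h.2 -
        flux (memLp_top_const 0) (memLp_top_const (ε ^ 2)⁻¹) (f - p.2) h.2) := rfl

theorem reducedEnergy_convex (hε : 0 < ε) {b₀ : ℝ} (hb₀ : 0 ≤ b₀)
    (hα' : ∀ᵐ x ∂(volume.restrict Ω), 0 ≤ α x) (hβ' : ∀ᵐ x ∂(volume.restrict Ω), b₀ ≤ β x)
    (p q : LpV Ω 3 × LpS Ω 3) :
    reducedEnergy α β f ε p + reducedForm hα hβ f ε p (q - p) + min b₀ ε / 16 * ‖q - p‖ ^ 3 ≤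
      reducedEnergy α β f ε q := by
  have e1 := energy_convex hα hβ hb₀ hα' hβ' p.1 q.1
  have e2 := energy_convex (memLp_top_const 0) (memLp_top_const ε) hε.le
    (Eventually.of_forall fun _ => le_rfl) (Eventually.of_forall fun _ => le_rfl) p.2 q.2
  -- Plain convexity is enough here, so the modulus is taken with constant `0`.
  have e3 := energy_convex (memLp_top_const 0) (memLp_top_const (ε ^ 2)⁻¹) le_rfl
    (Eventually.of_forall fun _ => le_rfl) (Eventually.of_forall fun _ => by positivity)
    (f - p.2) (f - q.2)
  have h3 : f - q.2 - (f - p.2) = -(q.2 - p.2) := by abel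
  rw [h3, map_neg] at e3
  have e4 : min b₀ ε / 16 * ‖q - p‖ ^ 3 ≤
      b₀ / 16 * ‖q.1 - p.1‖ ^ 3 + ε / 16 * ‖q.2 - p.2‖ ^ 3 := by
    -- The product norm is a maximum, so its cube is one of the two cubes on the right; this is why
    -- `min b₀ ε` appears.
    have hm : ‖q - p‖ = max ‖q.1 - p.1‖ ‖q.2 - p.2‖ := rfl
    have hmin : 0 ≤ min b₀ ε := le_min hb₀ hε.le
    rw [hm]
    rcases max_cases ‖q.1 - p.1‖ ‖q.2 - p.2‖ with ⟨h, _⟩ | ⟨h, _⟩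
    · rw [h]
      have : 0 ≤ ε / 16 * ‖q.2 - p.2‖ ^ 3 := by positivity
      refine le_add_of_le_of_nonneg ?_ this
      gcongr
      exact min_le_left _ _
    · rw [h]
      have : 0 ≤ b₀ / 16 * ‖q.1 - p.1‖ ^ 3 := by positivity
      refine le_add_of_nonneg_of_le this ?_
      gcongr
      exact min_le_right _ _
  rw [reducedForm_apply, reducedEnergy, reducedEnergy, Prod.fst_sub, Prod.snd_sub]
  linarith

theorem tendsto_reducedForm (p h : LpV Ω 3 × LpS Ω 3) :
    Tendsto (fun t : ℝ => reducedForm hα hβ f ε (p + t • h) h) (𝓝[>] 0)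
      (𝓝 (reducedForm hα hβ f ε p h)) := by
  have t1 := tendsto_flux hα hβ p.1 h.1
  have t2 := tendsto_flux (memLp_top_const 0) (memLp_top_const ε) p.2 h.2
  have t3 := (tendsto_flux (memLp_top_const 0) (memLp_top_const (ε ^ 2)⁻¹) (f - p.2) (-h.2)).neg
  simp only [map_neg, neg_neg] at t3
  refine (t1.add (t2.sub t3)).congr fun t => ?_
  have e : f - p.2 + t • -h.2 = f - (p + t • h).2 := by
    rw [Prod.snd_add, Prod.smul_snd, smul_neg]; abel
  rw [e]
  rfl

/-- Eliminating `S` reduces the regularized problem to one equation on the divergence graph. -/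
theorem isRegularizedSolution_iff (hε : 0 < ε) (Sb : E n → ℝ) (m : V Ω) (S : Q Ω) :
    IsRegularizedSolution α β f Sb ε m S ↔
      (∀ v : V Ω, reducedForm hα hβ f ε (m, weakDiv m) (v, weakDiv v) = formG Sb v) ∧
      S = (memLp_flux (memLp_top_const 0) (memLp_top_const (ε ^ 2)⁻¹)
        (Lp.memLp (f - weakDiv m))).toLp _ := by
  have hS : (∀ q : Q Ω, formC ε S q + formB m q = formF f q) ↔
      S = (memLp_flux (memLp_top_const 0) (memLp_top_const (ε ^ 2)⁻¹)
        (Lp.memLp (f - weakDiv m))).toLp _ := by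
    rw [forall_formC_add_formB_iff hε, Lp.ext_iff]
    have hc := (memLp_flux (memLp_top_const 0) (memLp_top_const (ε ^ 2)⁻¹)
      (Lp.memLp (f - weakDiv m))).coeFn_toLp
    exact ⟨fun h => EventuallyEq.trans h hc.symm, fun h => EventuallyEq.trans h hc⟩
  rw [IsRegularizedSolution, hS]
  -- The first equations are compared only under the formula for `S`, which turns the coupling term
  -- into a flux.
  refine and_congr_left fun hSeq => forall_congr' fun v => ?_
  have e1 : formA α β (m : LpV Ω 3) (v : LpV Ω 3) = flux hα hβ (m : LpV Ω 3) (v : LpV Ω 3) :=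
    (flux_apply hα hβ _ _).symm
  have e2 : formD ε m v =
      flux (memLp_top_const 0) (memLp_top_const ε) (weakDiv m) (weakDiv v) := by
    rw [flux_apply, formD, ← integral_const_mul]
    refine integral_congr_ae (Eventually.of_forall fun x => ?_)
    simp only [Real.norm_eq_abs, real_inner_eq_mul]
    ring
  have e3 : formB v S =
      flux (memLp_top_const 0) (memLp_top_const (ε ^ 2)⁻¹) (f - weakDiv m) (weakDiv v) := by
    rw [flux_apply, formB]
    refine integral_congr_ae ?_
    filter_upwards [(forall_formC_add_formB_iff hε f m S).1 (hS.2 hSeq)] with x hx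
    rw [hx, real_inner_eq_mul, smul_eq_mul]
    ring
  rw [e1, e2, e3, reducedForm_apply, add_sub_assoc]

end ReducedProblem

/-! ### Existence and uniqueness -/

/-- The reduced problem has exactly one solution. -/
theorem existsUnique_reduced {n : ℕ} {Ω : Set (E n)} [IsFiniteMeasure (volume.restrict Ω)]
    (hΩ : IsOpen Ω) {α β : E n → ℝ} (hα : MemLp α ⊤ (volume.restrict Ω))
    (hβ : MemLp β ⊤ (volume.restrict Ω)) {b₀ : ℝ} (hb₀ : 0 < b₀)
    (hα' : ∀ᵐ x ∂(volume.restrict Ω), 0 ≤ α x) (hβ' : ∀ᵐ x ∂(volume.restrict Ω), b₀ ≤ β x)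
    (f : LpS Ω 3) (Sb : E n → ℝ) {ε : ℝ} (hε : 0 < ε) :
    ∃! m : V Ω, ∀ v : V Ω,
      reducedForm hα hβ f ε (m, weakDiv m) (v, weakDiv v) = formG Sb v := by
  have : CompleteSpace (divGraph Ω) := (isClosed_divGraph Ω).completeSpace_coe
  obtain ⟨G, hG⟩ := exists_clm_eq_formG hΩ Sb
  obtain ⟨p, hp, hu⟩ := existsUnique_eq_of_cubic_modulus
    (J := fun p : divGraph Ω => reducedEnergy α β f ε p)
    (A := fun p => reducedForm hα hβ f ε p ∘L (divGraph Ω).subtypeL)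
    (c := min b₀ ε / 16) (by have := lt_min hb₀ hε; positivity)
    (fun p q => reducedEnergy_convex hα hβ f hε hb₀.le hα' hβ' p q)
    (fun p h => tendsto_reducedForm hα hβ f p h) G
  refine ⟨ofDivGraph Ω p, fun v => ?_, fun m hm => ?_⟩
  · have e : weakDiv (ofDivGraph Ω p) = p.1.2 := weakDiv_mk hΩ p.2
    have h := DFunLike.congr_fun hp (⟨(v, weakDiv v), weakDiv_spec v⟩ : divGraph Ω)
    rw [hG] at h
    rw [e]
    exact h
  -- Every solution `m` lifts to the graph point `(m, weakDiv m)`, so uniqueness there applies.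
  · have h := hu ⟨(m, weakDiv m), weakDiv_spec m⟩ (by
      ext q
      rw [hG, ← hm (ofDivGraph Ω q), show weakDiv (ofDivGraph Ω q) = q.1.2 from
        weakDiv_mk hΩ q.2]
      rfl)
    rw [← h]
    rfl

end DarcyForchheimer

theorem mainTheorem4 (n : ℕ) (hn : 1 ≤ n) (Ω : Set (DarcyForchheimer.E n))
    (hΩ : IsOpen Ω) (hΩb : Bornology.IsBounded Ω) (hΩr : DarcyForchheimer.HasC1Boundary Ω)
    (α β : DarcyForchheimer.E n → ℝ)
    (hα : MemLp α ⊤ (volume.restrict Ω)) (hβ : MemLp β ⊤ (volume.restrict Ω))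
    (αlo αhi βlo βhi : ℝ) (hαlo : 0 < αlo) (hβlo : 0 < βlo)
    (hαb : ∀ᵐ x ∂(volume.restrict Ω), αlo ≤ α x ∧ α x ≤ αhi)
    (hβb : ∀ᵐ x ∂(volume.restrict Ω), βlo ≤ β x ∧ β x ≤ βhi)
    (f : DarcyForchheimer.LpS Ω 3)
    (Sb : DarcyForchheimer.E n → ℝ) (hSb : DarcyForchheimer.MemSlobodeckij Ω (1 / 3) (3 / 2) Sb)
    (ε : ℝ) (hε : 0 < ε) :
    ∃! mS : DarcyForchheimer.V Ω × DarcyForchheimer.Q Ω,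
      DarcyForchheimer.IsRegularizedSolution α β f Sb ε mS.1 mS.2 := by
  have : IsFiniteMeasure (volume.restrict Ω) :=
    ⟨by rw [Measure.restrict_apply_univ]; exact hΩb.measure_lt_top⟩
  obtain ⟨m, hm, hu⟩ := DarcyForchheimer.existsUnique_reduced hΩ hα hβ hβlo
    (hαb.mono fun x hx => hαlo.le.trans hx.1) (hβb.mono fun x hx => hx.1) f Sb hε
  refine ⟨(m, _), (DarcyForchheimer.isRegularizedSolution_iff hα hβ f hε Sb m _).2 ⟨hm, rfl⟩, ?_⟩
  rintro ⟨m', S'⟩ h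
  obtain ⟨h1, h2⟩ := (DarcyForchheimer.isRegularizedSolution_iff hα hβ f hε Sb m' S').1 h
  obtain rfl := hu m' h1
  exact Prod.ext rfl h2
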